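/- Let $\widetilde L\subset\mathbb R^d\times\mathbb R^m$ be a lattice (a discrete subgroup of full rank), let $|\det\widetilde L|$ be the volume of its fundamental domain, and let $\pi_1,\pi_2$ be the projections onto $\mathbb R^d$ and $\mathbb R^m$. Assume that $\pi_1$ and $\pi_2$ are both one-to-one on $\widetilde L$ and that $\pi_1(\widetilde L)$ and $\pi_2(\widetilde L)$ are dense in $\mathbb R^d$ and $\mathbb R^m$, respectively. Put $L=\pi_1(\widetilde L)$ and, for $x\in L$, let $x^\star\in\mathbb R^m$ be the unique point with $(x,x^\star)\in\widetilde L$. Let $(\widetilde L)^*=\{y\in\mathbb R^d\times\mathbb R^m : y\cdot x\in\mathbb Z\text{ for all }x\in\widetilde L\}$ be the dual lattice and $L^*=\pi_1((\widetilde L)^*)$; the projection $\pi_1$ is one-to-one on $(\widetilde L)^*$, and for $k\in L^*$ let $k^\star\in\mathbb R^m$ be the unique point with $(k,k^\star)\in(\widetilde L)^*$. Let $B_r(a)\subset\mathbb R^d$ be the closed ball of radius $r$ centered at $a$. Let $f:\mathbb R^m\to\mathbb C$ be continuous with $|x|^{m+1+\alpha}|f(x)|\le C$ for all $x\in\mathbb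 R^m$, for some constants $C>0$ and $\alpha>0$. Then $f$ is integrable, and for all $k,a\in\mathbb R^d$ and $r>0$ the sum $$c_r(k)=\frac{1}{\operatorname{vol}(B_r(0))}\sum_{x\in L\cap B_r(a)}f(x^\star)\,e^{-2\pi i k\cdot x}$$ converges absolutely. For every $k\in\mathbb R^d$ the Fourier--Bohr coefficient $c(k)=\lim_{r\to\infty}c_r(k)$ exists for every $a\in\mathbb R^d$ and does not depend on $a$. If $k\in L^*$, then $$c(k)=\frac{1}{|\det\widetilde L|}\int_{\mathbb R^m}e^{2\pi i k^\star\cdot u}f(u)\,du=\frac{1}{|\det\widetilde L|}\,\widehat f(-k^\star),\qquad \widehat f(y)=\int_{\mathbb R^m}e^{-2\pi i y\cdot u}f(u)\,du,$$ and if $k\notin L^*$, then $c(k)=0$. -/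

import Mathlib

open MeasureTheory Filter Topology
open scoped FourierTransform

noncomputable section

namespace CutProject

/-- Euclidean space `ℝⁿ`. -/
abbrev Euc (n : ℕ) : Type := EuclideanSpace ℝ (Fin n)

variable {d m : ℕ}

/-- The image `π₁(Λ)` of a subgroup `Λ` of `ℝᵈ × ℝᵐ` under the projection to `ℝᵈ`. -/
def directModule (Λ : Submodule ℤ (Euc d × Euc m)) : Submodule ℤ (Euc d) :=
  Λ.map (LinearMap.fst ℤ (Euc d) (Euc m))

theorem exists_internal (Λ : Submodule ℤ (Euc d × Euc m)) (x : directModule Λ) :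
    ∃ y : Euc m, ((x : Euc d), y) ∈ Λ := by
  obtain ⟨x, hx⟩ := x
  obtain ⟨p, hp, rfl⟩ := Submodule.mem_map.1 hx
  exact ⟨p.2, hp⟩

/-- The star-map `π₂ ∘ (π₁|_Λ)⁻¹ : π₁(Λ) → ℝᵐ`: it sends `x` to the `y` with `(x, y) ∈ Λ`, which
is unique when `π₁|_Λ` is one-to-one (see `starMap_eq`). -/
def starMap (Λ : Submodule ℤ (Euc d × Euc m)) (x : directModule Λ) : Euc m :=
  (exists_internal Λ x).choose

theorem mk_starMap_mem (Λ : Submodule ℤ (Euc d × Euc m)) (x : directModule Λ) :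
    ((x : Euc d), starMap Λ x) ∈ Λ :=
  (exists_internal Λ x).choose_spec

theorem starMap_eq {Λ : Submodule ℤ (Euc d × Euc m)}
    (h : Set.InjOn Prod.fst (Λ : Set (Euc d × Euc m))) (x : directModule Λ) {y : Euc m}
    (hy : ((x : Euc d), y) ∈ Λ) : starMap Λ x = y :=
  congrArg Prod.snd (h (mk_starMap_mem Λ x) hy rfl)

/-- The dual lattice: all `y ∈ ℝᵈ × ℝᵐ` with `y · x ∈ ℤ` for all `x ∈ Λ`, where `·` is the
Euclidean scalar product of `ℝᵈ × ℝᵐ`. -/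
def dualLattice (Λ : Submodule ℤ (Euc d × Euc m)) : Submodule ℤ (Euc d × Euc m) where
  carrier := {y | ∀ x ∈ Λ, ∃ n : ℤ, inner ℝ y.1 x.1 + inner ℝ y.2 x.2 = (n : ℝ)}
  zero_mem' := fun x _ => ⟨0, by simp⟩
  add_mem' := by
    intro y z hy hz x hx
    obtain ⟨n, hn⟩ := hy x hx
    obtain ⟨l, hl⟩ := hz x hx
    refine ⟨n + l, ?_⟩
    push_cast
    rw [← hn, ← hl, Prod.fst_add, Prod.snd_add, inner_add_left, inner_add_left]
    ring
  smul_mem' := by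
    intro c y hy x hx
    obtain ⟨n, hn⟩ := hy x hx
    refine ⟨c * n, ?_⟩
    push_cast
    rw [← hn, Prod.smul_fst, Prod.smul_snd, ← Int.cast_smul_eq_zsmul ℝ c y.1,
      ← Int.cast_smul_eq_zsmul ℝ c y.2, real_inner_smul_left, real_inner_smul_left]
    ring

/-- If `π₂(Λ)` is dense, then `π₁` is one-to-one on the dual lattice, so that the star-map of the
dual lattice is well defined. -/
theorem injOn_fst_dualLattice {Λ : Submodule ℤ (Euc d × Euc m)}
    (h : Dense (Prod.snd '' (Λ : Set (Euc d × Euc m)))) :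
    Set.InjOn Prod.fst (dualLattice Λ : Set (Euc d × Euc m)) := by
  intro y hy z hz hyz
  have hsub : y - z ∈ dualLattice Λ := sub_mem hy hz
  have hfst : (y - z).1 = 0 := by simp [hyz]
  have hint : ∀ v : Euc m, ∃ n : ℤ, inner ℝ (y - z).2 v = (n : ℝ) := by
    intro v
    have hcl : IsClosed {v : Euc m | inner ℝ (y - z).2 v ∈ Set.range ((↑) : ℤ → ℝ)} :=
      Int.isClosedEmbedding_coe_real.isClosed_range.preimage (by fun_prop)
    have hall : Prod.snd '' (Λ : Set (Euc d × Euc m)) ⊆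
        {v : Euc m | inner ℝ (y - z).2 v ∈ Set.range ((↑) : ℤ → ℝ)} := by
      rintro _ ⟨x, hx, rfl⟩
      obtain ⟨n, hn⟩ := hsub x hx
      rw [hfst, inner_zero_left, zero_add] at hn
      exact ⟨n, hn.symm⟩
    obtain ⟨n, hn⟩ := closure_minimal hall hcl (h v)
    exact ⟨n, hn.symm⟩
  have hzero : (y - z).2 = 0 := by
    by_contra hne
    have hq : inner ℝ (y - z).2 (y - z).2 ≠ 0 := fun h0 => hne (inner_self_eq_zero.1 h0)
    obtain ⟨n, hn⟩ := hint ((2 * inner ℝ (y - z).2 (y - z).2)⁻¹ • (y - z).2)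
    rw [real_inner_smul_right] at hn
    have h2 : (2 * n : ℝ) = 1 := by
      rw [← hn]
      field_simp
    have h3 : 2 * n = 1 := by exact_mod_cast h2
    omega
  exact sub_eq_zero.1 (Prod.ext hfst hzero)

/-- The term `f(x^⋆) e^{-2πi k·x}`, for `x ∈ π₁(Λ)`. -/
def bohrTerm (Λ : Submodule ℤ (Euc d × Euc m)) (f : Euc m → ℂ) (k : Euc d)
    (x : directModule Λ) : ℂ :=
  f (starMap Λ x) * Complex.exp (-(2 * Real.pi * Complex.I * (inner ℝ k (x : Euc d) : ℝ)))

/-- The points of `π₁(Λ)` in the closed ball of radius `r` around `a`. -/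
def pointsInBall (Λ : Submodule ℤ (Euc d × Euc m)) (a : Euc d) (r : ℝ) :
    Set (directModule Λ) :=
  {x | (x : Euc d) ∈ Metric.closedBall a r}

/-- The finite volume approximation
`c_r(k) = vol(B_r(0))⁻¹ ∑_{x ∈ π₁(Λ) ∩ B_r(a)} f(x^⋆) e^{-2πi k·x}`. -/
def bohrApprox (Λ : Submodule ℤ (Euc d × Euc m)) (f : Euc m → ℂ) (k a : Euc d) (r : ℝ) : ℂ :=
  (((volume (Metric.closedBall (0 : Euc d) r)).toReal : ℂ))⁻¹ *
    ∑' x : pointsInBall Λ a r, bohrTerm Λ f k x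

end CutProject

end

/-! The sharp cutoff to a ball is replaced by a smooth one. For a mollifier φ, the indicator of B =
B_r(a) at x differs from ∫_B φ(x - t) dt only for x near the sphere. The resulting change in the sum
weighted by f is O(volume of a shell of width 2), hence o(r^d) (`tendsto_ballTerm_sub_ballAvg`).

After interchanging sum and integral, the smoothed c_r(k) is the average over t ∈ B of e^{-2πi k·t}
H(-t, 0), where H is the sum over all Λ-translates of q(x, u) = φ(x) e^{-2πi k·x} f(u)
(`periodize_mollifiedTerm`). The decay of f and the compact support of φ dominate q by an integrable
weight, so H is continuous and Λ-periodic.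

Such an H is a uniform limit of trigonometric polynomials with frequencies y in the dual lattice
(`exists_trigPolynomial_near`). Averages of a nontrivial character over growing balls vanish in the
limit, whatever the centre (`tendsto_ballAvg_character`), so only frequencies with y.1 = -k
contribute. If k ∉ L^*, there are none. If k ∈ L^*, injectivity of π₁ on the dual lattice leaves
only -y₀ with y₀ = (k, k^⋆), and the limit is the Fourier coefficient of H at -y₀. Unfolding the
integral of H over a fundamental domain to all of ℝᵈ × ℝᵐ, the phases in x cancel, φ integrates to
1, and the integral of e^{2πi k^⋆·u} f(u) remains. -/

noncomputable section

namespace CutProject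

open scoped Pointwise

set_option linter.unusedSectionVars false

/-! ### Periodization over a lattice of functions dominated by a moderate weight -/

section Periodization

variable {E : Type*} [NormedAddCommGroup E] [NormedSpace ℝ E] [FiniteDimensional ℝ E]
  [MeasurableSpace E] [BorelSpace E] {μ : Measure E} [μ.IsAddHaarMeasure]

/-- A nonnegative integrable weight whose values at points of bounded distance are comparable. -/
structure IsModerateWeight (μ : Measure E) (J : E → ℝ) : Prop where
  nonneg : ∀ z, 0 ≤ J z
  integrable : Integrable J μ
  exists_le_mul : ∀ R : ℝ, ∃ K : ℝ, 0 ≤ K ∧ ∀ z w : E, ‖w‖ ≤ R → J z ≤ K * J (z + w)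

variable (L : Submodule ℤ E) [DiscreteTopology L] [IsZLattice ℝ L]

/-- The standard fundamental domain of a lattice, for a choice of a basis. -/
def fundDomain : Set E :=
  ZSpan.fundamentalDomain ((Module.Free.chooseBasis ℤ L).ofZLatticeBasis ℝ L)

theorem isAddFundamentalDomain_fundDomain (μ : Measure E) :
    IsAddFundamentalDomain L (fundDomain L) μ :=
  ZLattice.isAddFundamentalDomain (Module.Free.chooseBasis ℤ L) μ

theorem isBounded_fundDomain : Bornology.IsBounded (fundDomain L) :=
  ZSpan.fundamentalDomain_isBounded _

theorem measure_fundDomain_lt_top : μ (fundDomain L) < ⊤ :=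
  (isBounded_fundDomain L).measure_lt_top

theorem measure_fundDomain_ne_zero : μ (fundDomain L) ≠ 0 :=
  ZSpan.measure_fundamentalDomain_ne_zero _

theorem measurableSet_fundDomain : MeasurableSet (fundDomain L) :=
  ZSpan.fundamentalDomain_measurableSet _

instance : MeasurableVAdd L E := (inferInstance : MeasurableVAdd L.toAddSubgroup E)

instance : VAddInvariantMeasure L E μ :=
  (inferInstance : VAddInvariantMeasure L.toAddSubgroup E μ)

theorem exists_norm_le_of_mem_fundDomain : ∃ R, ∀ z ∈ fundDomain L, ‖z‖ ≤ R :=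
  (isBounded_fundDomain L).exists_norm_le

variable {L}

theorem lintegral_eq_tsum_fundDomain (g : E → ENNReal) :
    ∫⁻ z, g z ∂μ = ∑' l : L, ∫⁻ z in fundDomain L, g (z + l) ∂μ := by
  rw [(isAddFundamentalDomain_fundDomain L μ).lintegral_eq_tsum'' g]
  refine tsum_congr fun l => ?_
  simp [Submodule.vadd_def, add_comm]

theorem integral_eq_tsum_fundDomain {g : E → ℂ} (hg : Integrable g μ) :
    ∫ z, g z ∂μ = ∑' l : L, ∫ z in fundDomain L, g (z + l) ∂μ := by
  rw [(isAddFundamentalDomain_fundDomain L μ).integral_eq_tsum'' g hg]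
  refine tsum_congr fun l => ?_
  simp [Submodule.vadd_def, add_comm]

/-- Integral comparison: up to a constant, J l times the cell volume is at most the integral of J
over the cell at l, and the cells tile the space. -/
theorem IsModerateWeight.summable {J : E → ℝ} (hJ : IsModerateWeight μ J) :
    Summable fun l : L => J l := by
  obtain ⟨R, hR⟩ := exists_norm_le_of_mem_fundDomain L
  obtain ⟨K, hK0, hK⟩ := hJ.exists_le_mul R
  have hfin : ∑' l : L, ∫⁻ z in fundDomain L, ENNReal.ofReal (K * J (z + l)) ∂μ ≠ ⊤ := by
    rw [← lintegral_eq_tsum_fundDomain (fun z => ENNReal.ofReal (K * J z))]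
    have h := (hJ.integrable.const_mul K).lintegral_lt_top
    exact h.ne
  have hle : ∀ l : L, ENNReal.ofReal (J l) * μ (fundDomain L) ≤
      ∫⁻ z in fundDomain L, ENNReal.ofReal (K * J (z + l)) ∂μ := by
    intro l
    rw [← setLIntegral_const]
    refine setLIntegral_mono_ae' (measurableSet_fundDomain L) (ae_of_all _ fun z hz => ?_)
    refine ENNReal.ofReal_le_ofReal ?_
    rw [add_comm]
    exact hK _ _ (hR z hz)
  have hfin2 : ∑' l : L, ENNReal.ofReal (J l) * μ (fundDomain L) ≠ ⊤ :=
    ne_top_of_le_ne_top hfin (ENNReal.tsum_le_tsum hle)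
  rw [ENNReal.tsum_mul_right] at hfin2
  have hfin3 : ∑' l : L, ENNReal.ofReal (J l) ≠ ⊤ := by
    intro h
    rw [h, ENNReal.top_mul (measure_fundDomain_ne_zero L)] at hfin2
    exact hfin2 rfl
  have := ENNReal.summable_toReal hfin3
  simpa only [ENNReal.toReal_ofReal (hJ.nonneg _)] using this

/-- Shifted values of a dominated function are dominated by the weight, locally uniformly. -/
theorem IsModerateWeight.exists_norm_shift_le {J : E → ℝ} (hJ : IsModerateWeight μ J) {q : E → ℂ}
    {M : ℝ} (hM : 0 ≤ M) (hq : ∀ z, ‖q z‖ ≤ M * J z) (R : ℝ) :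
    ∃ K : ℝ, 0 ≤ K ∧ ∀ w, ‖w‖ ≤ R → ∀ z, ‖q (w + z)‖ ≤ K * J z := by
  obtain ⟨K, hK0, hK⟩ := hJ.exists_le_mul R
  refine ⟨M * K, by positivity, fun w hw z => (hq _).trans ?_⟩
  rw [mul_assoc]
  refine mul_le_mul_of_nonneg_left ?_ hM
  have := hK (w + z) (-w) (by simpa using hw)
  simpa using this

variable (L) in
/-- The sum of a function over the translates of a point by a lattice. -/
def periodize (q : E → ℂ) (z : E) : ℂ := ∑' l : L, q (z + l)

/-- Weierstrass M-test on unit balls: moderateness makes the dominating series independent of the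
point in the ball. -/
theorem IsModerateWeight.continuous_periodize {J : E → ℝ} (hJ : IsModerateWeight μ J) {q : E → ℂ}
    {M : ℝ} (hM : 0 ≤ M) (hq : ∀ z, ‖q z‖ ≤ M * J z) (hqc : Continuous q) :
    Continuous (periodize L q) := by
  rw [continuous_iff_continuousAt]
  intro z
  obtain ⟨K, -, hK⟩ := hJ.exists_norm_shift_le hM hq (‖z‖ + 1)
  have hon : ContinuousOn (periodize L q) (Metric.ball z 1) := by
    refine continuousOn_tsum (u := fun l : L => K * J l) (fun l => by fun_prop)
      (hJ.summable.mul_left K) fun l w hw => hK w ?_ l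
    have h1 : ‖w - z‖ < 1 := by simpa [dist_eq_norm] using hw
    have h2 : ‖w‖ ≤ ‖z‖ + ‖w - z‖ := by simpa using norm_add_le z (w - z)
    linarith
  exact hon.continuousAt (Metric.ball_mem_nhds z one_pos)

theorem periodize_add (q : E → ℂ) (z : E) (l : L) :
    periodize L q (z + l) = periodize L q z := by
  unfold periodize
  rw [← (Equiv.addLeft l).tsum_eq (fun l' : L => q (z + l'))]
  simp [add_assoc]

theorem exists_sub_mem_fundDomain (z : E) : ∃ l : L, z + l ∈ fundDomain L := by
  set b := Module.Free.chooseBasis ℤ L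
  obtain ⟨v, hv, -⟩ := ZSpan.exist_unique_vadd_mem_fundamentalDomain (b.ofZLatticeBasis ℝ L) z
  have hmem : (v : E) ∈ L := (b.ofZLatticeBasis_span ℝ).le v.2
  refine ⟨⟨v, hmem⟩, ?_⟩
  rw [Submodule.vadd_def, vadd_eq_add, add_comm] at hv
  exact hv

theorem exists_norm_le_of_periodic {H : E → ℂ} (hH : Continuous H)
    (hper : ∀ z, ∀ l : L, H (z + l) = H z) : ∃ K : ℝ, 0 ≤ K ∧ ∀ z, ‖H z‖ ≤ K := by
  have hc : IsCompact (closure (fundDomain L)) := (isBounded_fundDomain L).isCompact_closure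
  obtain ⟨K, hK⟩ := hc.exists_bound_of_continuousOn hH.continuousOn
  have hb : ∀ z, ‖H z‖ ≤ K := by
    intro z
    obtain ⟨l, hl⟩ := exists_sub_mem_fundDomain (L := L) z
    rw [← hper z l]
    exact hK _ (subset_closure hl)
  exact ⟨K, (norm_nonneg _).trans (hb 0), hb⟩

/-- Unfolding: the translates of the fundamental domain tile the space, and domination justifies
exchanging sum and integral. -/
theorem IsModerateWeight.setIntegral_periodize {J : E → ℝ} (hJ : IsModerateWeight μ J)
    {q : E → ℂ} {M : ℝ} (hM : 0 ≤ M) (hq : ∀ z, ‖q z‖ ≤ M * J z) (hqc : Continuous q) :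
    ∫ z in fundDomain L, periodize L q z ∂μ = ∫ z, q z ∂μ := by
  have hint : Integrable q μ :=
    (hJ.integrable.const_mul M).mono' hqc.aestronglyMeasurable (ae_of_all _ hq)
  rw [integral_eq_tsum_fundDomain (L := L) hint]
  obtain ⟨R, hR⟩ := exists_norm_le_of_mem_fundDomain L
  obtain ⟨K, -, hK⟩ := hJ.exists_norm_shift_le hM hq R
  have hfin : IsFiniteMeasure (μ.restrict (fundDomain L)) :=
    ⟨by simpa using measure_fundDomain_lt_top L⟩
  have hbd : ∀ l : L, ∀ᵐ z ∂μ.restrict (fundDomain L), ‖q (z + l)‖ ≤ K * J l := fun l =>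
    (ae_restrict_iff' (measurableSet_fundDomain L)).2 (ae_of_all _ fun z hz => hK z (hR z hz) l)
  have hi : ∀ l : L, Integrable (fun z => q (z + l)) (μ.restrict (fundDomain L)) := fun l =>
    Integrable.of_bound (by fun_prop) (K * J l) (hbd l)
  refine (integral_tsum_of_summable_integral_norm hi ?_).symm
  refine Summable.of_nonneg_of_le (fun l => integral_nonneg fun _ => norm_nonneg _) (fun l => ?_)
    ((hJ.summable.mul_left K).mul_right (μ.real (fundDomain L)))
  calc ∫ z in fundDomain L, ‖q (z + l)‖ ∂μ ≤ ∫ z in fundDomain L, K * J l ∂μ :=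
        integral_mono_ae (hi l).norm (integrable_const _) (hbd l)
    _ = K * J l * μ.real (fundDomain L) := by simp [mul_comm]

end Periodization

/-! ### Averages over growing balls -/

section BallAverages

variable {d : ℕ}

/-- The volume of a closed ball of radius `r`, as a real number. -/
def ballVol (d : ℕ) (r : ℝ) : ℝ := (volume (Metric.closedBall (0 : Euc d) r)).toReal

theorem volume_real_closedBall (a : Euc d) {r : ℝ} (hr : 0 ≤ r) :
    volume.real (Metric.closedBall a r) = r ^ d * volume.real (Metric.ball (0 : Euc d) 1) := by
  rw [Measure.real, Measure.addHaar_closedBall _ _ hr, ENNReal.toReal_mul,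
    ENNReal.toReal_ofReal (by positivity)]
  simp [Measure.real]

theorem volume_real_ball_pos : 0 < volume.real (Metric.ball (0 : Euc d) 1) :=
  ENNReal.toReal_pos (Metric.measure_ball_pos _ _ one_pos).ne' measure_ball_lt_top.ne

theorem ballVol_eq {r : ℝ} (hr : 0 ≤ r) :
    ballVol d r = r ^ d * volume.real (Metric.ball (0 : Euc d) 1) :=
  volume_real_closedBall 0 hr

theorem volume_real_closedBall_eq_ballVol (a : Euc d) {r : ℝ} (hr : 0 ≤ r) :
    volume.real (Metric.closedBall a r) = ballVol d r := by
  rw [volume_real_closedBall a hr, ballVol_eq hr]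

theorem ballVol_pos {r : ℝ} (hr : 0 < r) : 0 < ballVol d r := by
  rw [ballVol_eq hr.le]
  have := volume_real_ball_pos (d := d)
  positivity

/-- The points whose distance to the sphere of radius `r` around `a` is at most about `ρ`. -/
def shell (a : Euc d) (r ρ : ℝ) : Set (Euc d) :=
  Metric.closedBall a (r + ρ) \ Metric.closedBall a (r - ρ)

theorem measurableSet_shell (a : Euc d) (r ρ : ℝ) : MeasurableSet (shell a r ρ) :=
  Metric.isClosed_closedBall.measurableSet.diff Metric.isClosed_closedBall.measurableSet

theorem isBounded_shell (a : Euc d) (r ρ : ℝ) : Bornology.IsBounded (shell a r ρ) :=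
  Metric.isBounded_closedBall.subset Set.sdiff_subset

theorem volume_shell_lt_top (a : Euc d) (r ρ : ℝ) : volume (shell a r ρ) < ⊤ :=
  (isBounded_shell a r ρ).measure_lt_top

/-- By scaling, the quotient equals (1 + ρ/r)^d - (1 - ρ/r)^d once r ≥ ρ. -/
theorem tendsto_volume_shell_div (a : Euc d) {ρ : ℝ} (hρ : 0 ≤ ρ) :
    Tendsto (fun r : ℝ => volume.real (shell a r ρ) / ballVol d r) atTop (𝓝 0) := by
  have h0 : Tendsto (fun r : ℝ => ρ / r) atTop (𝓝 0) := tendsto_const_nhds.div_atTop tendsto_id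
  have h1 : Tendsto (fun r : ℝ => (1 + ρ / r) ^ d - (1 - ρ / r) ^ d) atTop (𝓝 0) := by
    simpa using ((h0.const_add 1).pow d).sub ((h0.const_sub 1).pow d)
  refine h1.congr' ?_
  filter_upwards [eventually_gt_atTop (0 : ℝ), eventually_ge_atTop ρ] with r hr hrρ
  have hpos := volume_real_ball_pos (d := d)
  have hr' : (r ^ d) ≠ 0 := by positivity
  rw [shell, measureReal_sdiff (Metric.closedBall_subset_closedBall (by linarith))
    Metric.isClosed_closedBall.measurableSet measure_closedBall_lt_top.ne,
    volume_real_closedBall a (by linarith), volume_real_closedBall a (by linarith), ballVol_eq hr.le, ← sub_mul,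
    mul_div_mul_right _ _ hpos.ne', sub_div, ← div_pow, ← div_pow, add_div, sub_div,
    div_self hr.ne']

/-- The average of a function over the closed ball of radius `r` around `a`. -/
def ballAvg (a : Euc d) (r : ℝ) (g : Euc d → ℂ) : ℂ :=
  ((ballVol d r : ℝ) : ℂ)⁻¹ * ∫ t in Metric.closedBall a r, g t

theorem norm_ballVol_inv_mul (r : ℝ) (z : ℂ) :
    ‖((ballVol d r : ℝ) : ℂ)⁻¹ * z‖ = ‖z‖ / ballVol d r := by
  rw [norm_mul, norm_inv, Complex.norm_real, Real.norm_of_nonneg (r := ballVol d r) ENNReal.toReal_nonneg]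
  ring

theorem norm_ballAvg_le {a : Euc d} {r : ℝ} (hr : 0 < r) {g : Euc d → ℂ} {K : ℝ}
    (hg : ∀ t, ‖g t‖ ≤ K) : ‖ballAvg a r g‖ ≤ K := by
  rw [ballAvg, norm_ballVol_inv_mul, div_le_iff₀ (ballVol_pos hr),
    ← volume_real_closedBall_eq_ballVol a hr.le]
  exact norm_setIntegral_le_of_norm_le_const measure_closedBall_lt_top fun t _ => hg t

theorem ballAvg_const {a : Euc d} {r : ℝ} (hr : 0 < r) (z : ℂ) :
    ballAvg a r (fun _ => z) = z := by
  have hne : ((ballVol d r : ℝ) : ℂ) ≠ 0 := by exact_mod_cast (ballVol_pos hr).ne'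
  rw [ballAvg, setIntegral_const, volume_real_closedBall_eq_ballVol a hr.le, Complex.real_smul,
    inv_mul_cancel_left₀ hne]

/-- Both balls lie between the concentric balls of radii r - ‖w‖ and r + ‖w‖ around a. Comparing
each with the inner one costs one shell volume, whence the factor 2. -/
theorem norm_setIntegral_closedBall_sub_le {a w : Euc d} {r : ℝ} {g : Euc d → ℂ}
    (hg : Continuous g) (h1 : ∀ t, ‖g t‖ ≤ 1) :
    ‖(∫ t in Metric.closedBall (a + w) r, g t) - ∫ t in Metric.closedBall a r, g t‖ ≤
      2 * volume.real (shell a r ‖w‖) := by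
  have key : ∀ c : Euc d, Metric.closedBall a (r - ‖w‖) ⊆ Metric.closedBall c r →
      Metric.closedBall c r ⊆ Metric.closedBall a (r + ‖w‖) →
      ‖(∫ t in Metric.closedBall c r, g t) - ∫ t in Metric.closedBall a (r - ‖w‖), g t‖ ≤
        volume.real (shell a r ‖w‖) := by
    intro c hc1 hc2
    have hint : IntegrableOn g (Metric.closedBall c r) :=
      hg.continuousOn.integrableOn_compact (isCompact_closedBall c r)
    rw [← setIntegral_sdiff Metric.isClosed_closedBall.measurableSet hint hc1]
    refine (norm_setIntegral_le_of_norm_le_const (C := 1) ?_ fun t _ => h1 t).trans ?_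
    · exact (measure_mono Set.sdiff_subset).trans_lt measure_closedBall_lt_top
    · rw [one_mul]
      exact measureReal_mono (Set.sdiff_subset_sdiff_left hc2) (volume_shell_lt_top a r ‖w‖).ne
  have hA := key (a + w) (Metric.closedBall_subset_closedBall' (by simp))
    (Metric.closedBall_subset_closedBall' (by simp))
  have hB := key a (Metric.closedBall_subset_closedBall (by linarith [norm_nonneg w]))
    (Metric.closedBall_subset_closedBall (by linarith [norm_nonneg w]))
  set I := ∫ t in Metric.closedBall a (r - ‖w‖), g t
  calc _ = ‖((∫ t in Metric.closedBall (a + w) r, g t) - I) -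
        ((∫ t in Metric.closedBall a r, g t) - I)‖ := by congr 1; ring
    _ ≤ _ := norm_sub_le _ _
    _ ≤ _ := by linarith

theorem setIntegral_closedBall_add (a w : Euc d) (r : ℝ) (g : Euc d → ℂ) :
    ∫ t in Metric.closedBall (a + w) r, g t = ∫ t in Metric.closedBall a r, g (t + w) := by
  rw [← (measurePreserving_add_right volume w).setIntegral_preimage_emb
    (measurableEmbedding_addRight w)]
  congr 2
  ext t
  simp [dist_eq_norm]

/-- The averages of a nontrivial character over growing balls tend to zero. -/
theorem tendsto_ballAvg_character (a : Euc d) {ξ : Euc d} (hξ : ξ ≠ 0) :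
    Tendsto (fun r : ℝ => ballAvg a r fun t => (𝐞 (inner ℝ ξ t) : ℂ)) atTop (𝓝 0) := by
  -- Half a period in the direction of ξ: translation by w negates the character.
  set w : Euc d := (2 * inner ℝ ξ ξ)⁻¹ • ξ
  have hw : inner ℝ ξ w = 1 / 2 := by
    have : inner ℝ ξ ξ ≠ 0 := fun h => hξ (inner_self_eq_zero.1 h)
    rw [real_inner_smul_right]
    field_simp
  have hew : (𝐞 (inner ℝ ξ w) : ℂ) = -1 := by
    rw [hw, Real.fourierChar_apply]
    rw [show ((2 * Real.pi * (1 / 2) : ℝ) : ℂ) * Complex.I = Real.pi * Complex.I by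
      push_cast; ring]
    exact Complex.exp_pi_mul_I
  have hlim := tendsto_volume_shell_div a (norm_nonneg w)
  refine squeeze_zero_norm' ?_ hlim
  filter_upwards [eventually_gt_atTop (0 : ℝ)] with r hr
  rw [ballAvg, norm_ballVol_inv_mul]
  refine div_le_div_of_nonneg_right ?_ (ballVol_pos hr).le
  have hb := norm_setIntegral_closedBall_sub_le (a := a) (w := w) (r := r)
    (g := fun t => (𝐞 (inner ℝ ξ t) : ℂ)) (by fun_prop) (fun t => (Circle.norm_coe _).le)
  -- The translated integral is the negative of the original one, so the left side becomes twice the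
  -- norm to be bounded.
  rw [setIntegral_closedBall_add] at hb
  simp only [inner_add_right, AddChar.map_add_eq_mul, Circle.coe_mul, hew] at hb
  simp only [mul_neg, mul_one, integral_neg] at hb
  rw [← neg_add', norm_neg, ← two_mul, norm_mul, Complex.norm_ofNat] at hb
  linarith

end BallAverages

/-! ### Characters of the dual lattice and trigonometric approximation -/

section Characters

variable {d m : ℕ}

/-- The Euclidean scalar product of `ℝᵈ × ℝᵐ`. -/
def pairing (y z : Euc d × Euc m) : ℝ := inner ℝ y.1 z.1 + inner ℝ y.2 z.2

/-- The character `z ↦ e^{2πi y·z}` of `ℝᵈ × ℝᵐ`. -/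
def chr (y z : Euc d × Euc m) : ℂ := (𝐞 (pairing y z) : ℂ)

@[fun_prop]
theorem continuous_chr (y : Euc d × Euc m) : Continuous (chr y) := by
  unfold chr pairing
  fun_prop

@[simp]
theorem norm_chr (y z : Euc d × Euc m) : ‖chr y z‖ = 1 := Circle.norm_coe _

theorem chr_add_right (y z w : Euc d × Euc m) : chr y (z + w) = chr y z * chr y w := by
  rw [chr, chr, chr, ← Circle.coe_mul, ← AddChar.map_add_eq_mul]
  congr 2
  simp only [pairing, Prod.fst_add, Prod.snd_add, inner_add_right]
  ring

theorem chr_add_left (y z w : Euc d × Euc m) : chr (y + z) w = chr y w * chr z w := by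
  rw [chr, chr, chr, ← Circle.coe_mul, ← AddChar.map_add_eq_mul]
  congr 2
  simp only [pairing, Prod.fst_add, Prod.snd_add, inner_add_left]
  ring

theorem fourierChar_intCast (n : ℤ) : (𝐞 (n : ℝ) : ℂ) = 1 := by
  rw [Real.fourierChar_apply, ← Complex.exp_int_mul_two_pi_mul_I n]
  congr 1
  push_cast
  ring

theorem chr_eq_one {Λ : Submodule ℤ (Euc d × Euc m)} {y : Euc d × Euc m}
    (hy : y ∈ dualLattice Λ) (l : Λ) : chr y l = 1 := by
  obtain ⟨n, hn⟩ := hy l l.2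
  rw [chr, pairing, hn, fourierChar_intCast]

theorem exists_chr_eq_neg_one {y : Euc d × Euc m} (hy : y ≠ 0) : ∃ w, chr y w = -1 := by
  have hpos : pairing y y ≠ 0 := by
    intro h
    have h1 : 0 ≤ inner ℝ y.1 y.1 := real_inner_self_nonneg
    have h2 : 0 ≤ inner ℝ y.2 y.2 := real_inner_self_nonneg
    unfold pairing at h
    exact hy (Prod.ext (inner_self_eq_zero.1 (by linarith : inner ℝ y.1 y.1 = 0))
      (inner_self_eq_zero.1 (by linarith : inner ℝ y.2 y.2 = 0)))
  refine ⟨(2 * pairing y y)⁻¹ • y, ?_⟩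
  have hw : pairing y ((2 * pairing y y)⁻¹ • y) = 1 / 2 := by
    have : pairing y ((2 * pairing y y)⁻¹ • y) = (2 * pairing y y)⁻¹ * pairing y y := by
      rw [pairing, Prod.smul_fst, Prod.smul_snd, real_inner_smul_right, real_inner_smul_right,
        ← mul_add]
      rfl
    rw [this]
    field_simp
  rw [chr, hw, Real.fourierChar_apply]
  rw [show ((2 * Real.pi * (1 / 2) : ℝ) : ℂ) * Complex.I = Real.pi * Complex.I by push_cast; ring]
  exact Complex.exp_pi_mul_I

/-- The product carries the sup norm, so Riesz representation is applied on each factor. -/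
theorem exists_pairing_eq (φ : Euc d × Euc m →ₗ[ℝ] ℝ) :
    ∃ y : Euc d × Euc m, ∀ z, pairing y z = φ z := by
  set φ₁ : Euc d →L[ℝ] ℝ := (φ ∘ₗ LinearMap.inl ℝ _ _).toContinuousLinearMap
  set φ₂ : Euc m →L[ℝ] ℝ := (φ ∘ₗ LinearMap.inr ℝ _ _).toContinuousLinearMap
  refine ⟨((InnerProductSpace.toDual ℝ _).symm φ₁, (InnerProductSpace.toDual ℝ _).symm φ₂),
    fun z => ?_⟩
  simp only [pairing, InnerProductSpace.toDual_symm_apply]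
  simp [φ₁, φ₂, ← map_add]

instance : (volume : Measure (Euc d × Euc m)).IsAddHaarMeasure :=
  inferInstanceAs (((volume : Measure (Euc d)).prod
    (volume : Measure (Euc m))).IsAddHaarMeasure)

variable {Λ : Submodule ℤ (Euc d × Euc m)} [DiscreteTopology Λ] [IsZLattice ℝ Λ]

/-- Nontrivial characters in the dual lattice have mean zero over a fundamental domain. -/
theorem setIntegral_chr_eq_zero {y : Euc d × Euc m} (hy : y ∈ dualLattice Λ) (hy0 : y ≠ 0) :
    ∫ z in fundDomain Λ, chr y z = 0 := by
  obtain ⟨w, hw⟩ := exists_chr_eq_neg_one hy0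
  have hF := isAddFundamentalDomain_fundDomain Λ (volume : Measure (Euc d × Euc m))
  -- The translate by w is again a fundamental domain, so the periodic integrand has equal integrals
  -- over both; yet translation by w multiplies it by -1.
  have hF' := hF.vadd_of_comm w
  have heq := hF.setIntegral_eq hF' (f := chr y) (fun l z => by
    rw [Submodule.vadd_def, vadd_eq_add, chr_add_right, chr_eq_one hy, one_mul])
  have hpre : (fun z => w + z) ⁻¹' (w +ᵥ fundDomain Λ) = fundDomain Λ := by
    ext z
    simp [Set.mem_vadd_set]
  rw [← (measurePreserving_add_left volume w).setIntegral_preimage_emb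
    (measurableEmbedding_addLeft w) _ (w +ᵥ fundDomain Λ), hpre] at heq
  simp only [chr_add_right, hw, neg_one_mul, integral_neg] at heq
  exact self_eq_neg.1 heq

/-- Continuous periodic functions are uniform limits of combinations of characters in the dual
lattice. -/
theorem exists_trigPolynomial_near {H : Euc d × Euc m → ℂ} (hH : Continuous H)
    (hper : ∀ z, ∀ l : Λ, H (z + l) = H z) {ε : ℝ} (hε : 0 < ε) :
    ∃ p : dualLattice Λ →₀ ℂ, ∀ z, ‖H z - p.sum fun y c => c * chr y z‖ ≤ ε := by
  classical
  obtain ⟨ι, _, ⟨b⟩⟩ : ∃ (ι : Type) (_ : Fintype ι), Nonempty (Module.Basis ι ℤ Λ) :=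
    ⟨_, inferInstance, ⟨Module.Free.chooseBasis ℤ Λ⟩⟩
  set B := b.ofZLatticeBasis ℝ Λ with hB
  -- In coordinates of a lattice basis Λ becomes ℤ^ι, so H descends to a continuous function on the
  -- torus, where trigonometric polynomials are dense.
  have hquot : IsOpenQuotientMap (Pi.map fun (_ : ι) (t : ℝ) => (t : UnitAddCircle)) :=
    IsOpenQuotientMap.piMap fun _ => QuotientAddGroup.isOpenQuotientMap_mk
  set π : C(ι → ℝ, UnitAddTorus ι) := ⟨_, hquot.continuous⟩ with hπ
  set G : C(ι → ℝ, ℂ) := ⟨fun v => H (B.equivFun.symm v), hH.comp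
    (LinearMap.continuous_of_finiteDimensional B.equivFun.symm.toLinearMap)⟩
  have hfac : Function.FactorsThrough G π := by
    intro v v' hvv
    have hn : ∀ i, ∃ n : ℤ, v i = v' i + n := by
      intro i
      have h1 : ((v i : ℝ) : UnitAddCircle) = (v' i : ℝ) := congrFun hvv i
      rw [← sub_eq_zero, ← AddCircle.coe_sub, AddCircle.coe_eq_zero_iff] at h1
      obtain ⟨n, hn⟩ := h1
      exact ⟨n, by simp at hn; linarith⟩
    choose n hn using hn
    have hl : B.equivFun.symm v = B.equivFun.symm v' + ((∑ i, n i • b i : Λ) : Euc d × Euc m) := by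
      simp only [Module.Basis.equivFun_symm_apply, hn, add_smul, Finset.sum_add_distrib]
      congr 1
      rw [Submodule.coe_sum]
      refine Finset.sum_congr rfl fun i _ => ?_
      rw [hB, Module.Basis.ofZLatticeBasis_apply, Submodule.coe_smul, Int.cast_smul_eq_zsmul]
    show H _ = H _
    rw [hl, hper]
  set T : C(UnitAddTorus ι, ℂ) := Topology.IsQuotientMap.lift (f := π) hquot.isQuotientMap G hfac
  have hT : ∀ v, T (π v) = H (B.equivFun.symm v) := fun v =>
    congrArg (fun g : C(ι → ℝ, ℂ) => g v)
      (Topology.IsQuotientMap.lift_comp (f := π) hquot.isQuotientMap G hfac)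
  have hcl : T ∈ closure (Submodule.span ℂ (Set.range (UnitAddTorus.mFourier (d := ι))) :
      Set C(UnitAddTorus ι, ℂ)) := by
    rw [← Submodule.topologicalClosure_coe, UnitAddTorus.span_mFourier_closure_eq_top]
    trivial
  obtain ⟨P, hP, hTP⟩ := Metric.mem_closure_iff.1 hcl ε hε
  obtain ⟨c, rfl⟩ := Finsupp.mem_span_range_iff_exists_finsupp.1 hP
  -- The torus character n pulls back to the character of the y representing ∑ n i • B.coord i, a
  -- functional with integer values on Λ.
  have hfreq : ∀ n : ι → ℤ, ∃ y : dualLattice Λ, ∀ z,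
      pairing (y : Euc d × Euc m) z = ∑ i, (n i : ℝ) * B.repr z i := by
    intro n
    obtain ⟨y, hy⟩ := exists_pairing_eq (∑ i, (n i : ℝ) • B.coord i)
    have hy' : ∀ z, pairing y z = ∑ i, (n i : ℝ) * B.repr z i := by
      intro z
      rw [hy]
      simp [LinearMap.sum_apply]
    refine ⟨⟨y, fun x hx => ⟨∑ i, n i * b.repr ⟨x, hx⟩ i, ?_⟩⟩, hy'⟩
    rw [← pairing, hy']
    push_cast
    refine Finset.sum_congr rfl fun i _ => ?_
    rw [← Module.Basis.ofZLatticeBasis_repr_apply ℝ Λ b ⟨x, hx⟩ i]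
  choose y hy using hfreq
  have hchr : ∀ n z, chr (y n) z = UnitAddTorus.mFourier n (π (B.equivFun z)) := by
    intro n z
    rw [chr, hy, Real.fourierChar_apply]
    simp only [UnitAddTorus.mFourier, ContinuousMap.coe_mk, hπ, Pi.map_apply, fourier_coe_apply,
      ← Complex.exp_sum]
    congr 1
    push_cast
    rw [Finset.mul_sum, Finset.sum_mul]
    refine Finset.sum_congr rfl fun i _ => ?_
    simp
    ring
  -- Injectivity of `y` is not needed: `mapDomain` adds the coefficients of coinciding frequencies.
  refine ⟨c.mapDomain y, fun z => ?_⟩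
  have hsum : ((c.mapDomain y).sum fun y c => c * chr y z) =
      c.sum fun n a => a * chr (y n) z :=
    Finsupp.sum_mapDomain_index_addMonoidHom
      (fun y : dualLattice Λ => AddMonoidHom.mulRight (chr (y : Euc d × Euc m) z))
  have hz : H z = T (π (B.equivFun z)) := by rw [hT]; simp
  rw [hsum, hz]
  have hval : (c.sum fun n a => a * chr (y n) z) =
      (c.sum fun n a => a • UnitAddTorus.mFourier n) (π (B.equivFun z)) := by
    rw [Finsupp.sum, Finsupp.sum, ContinuousMap.sum_apply]
    refine Finset.sum_congr rfl fun n _ => ?_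
    rw [hchr]
    rfl
  rw [hval, ← dist_eq_norm]
  exact (ContinuousMap.dist_apply_le_dist _).trans hTP.le

end Characters

/-! ### Mean values of periodic functions along ℝᵈ -/

section MeanValues

variable {d m : ℕ} {Λ : Submodule ℤ (Euc d × Euc m)} [DiscreteTopology Λ] [IsZLattice ℝ Λ]

theorem fourierChar_mul_chr (k t : Euc d) (y : Euc d × Euc m) :
    (𝐞 (-inner ℝ k t) : ℂ) * chr y (-t, 0) = 𝐞 (inner ℝ (-k - y.1) t) := by
  rw [chr, ← Circle.coe_mul, ← AddChar.map_add_eq_mul]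
  congr 2
  simp only [pairing, inner_zero_right, inner_neg_right, inner_sub_left, inner_neg_left]
  ring

open Classical in
-- Evaluated at (-t, 0), the frequency y contributes the character of -k - y.1, which is trivial
-- exactly when y.1 = -k.
theorem tendsto_ballAvg_trigPolynomial (k a : Euc d) (p : dualLattice Λ →₀ ℂ) :
    Tendsto (fun r : ℝ => ballAvg a r fun t =>
      (𝐞 (-inner ℝ k t) : ℂ) * p.sum fun y c => c * chr y.1 (-t, 0)) atTop
      (𝓝 (∑ y ∈ p.support with y.1.1 = -k, p y)) := by
  have hterm : ∀ y : dualLattice Λ, Tendsto (fun r : ℝ => p y *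
      ballAvg a r fun t => (𝐞 (inner ℝ (-k - y.1.1) t) : ℂ)) atTop
      (𝓝 (if y.1.1 = -k then p y else 0)) := by
    intro y
    split_ifs with h
    · refine tendsto_const_nhds.congr' ?_
      filter_upwards [eventually_gt_atTop (0 : ℝ)] with r hr
      simp [h, ballAvg_const hr]
    · simpa using (tendsto_ballAvg_character a (sub_ne_zero.2 (Ne.symm h))).const_mul (p y)
  rw [Finset.sum_filter]
  refine (tendsto_finsetSum p.support fun y _ => hterm y).congr fun r => ?_
  have hfun : ∀ t, (𝐞 (-inner ℝ k t) : ℂ) * (p.sum fun y c => c * chr y.1 (-t, 0)) =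
      ∑ y ∈ p.support, p y * (𝐞 (inner ℝ (-k - y.1.1) t) : ℂ) := by
    intro t
    rw [Finsupp.sum, Finset.mul_sum]
    refine Finset.sum_congr rfl fun y _ => ?_
    rw [← fourierChar_mul_chr]
    ring
  simp only [hfun, ballAvg]
  rw [integral_finsetSum, Finset.mul_sum]
  · refine Finset.sum_congr rfl fun y _ => ?_
    rw [integral_const_mul]
    ring
  · intro y _
    have hc : Continuous fun t => p y * (𝐞 (inner ℝ (-k - y.1.1) t) : ℂ) := by fun_prop
    exact hc.continuousOn.integrableOn_compact (isCompact_closedBall a r)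

theorem ballAvg_sub {a : Euc d} {r : ℝ} {g h : Euc d → ℂ} (hg : Continuous g)
    (hh : Continuous h) : ballAvg a r (fun t => g t - h t) = ballAvg a r g - ballAvg a r h := by
  rw [ballAvg, ballAvg, ballAvg, integral_sub, mul_sub]
  · exact hg.continuousOn.integrableOn_compact (isCompact_closedBall a r)
  · exact hh.continuousOn.integrableOn_compact (isCompact_closedBall a r)

open Classical in
/-- Along `ℝᵈ`, the twisted averages of a continuous periodic function converge to every number
that is compatible with approximation by trigonometric polynomials. -/
theorem tendsto_ballAvg_periodic {H : Euc d × Euc m → ℂ} (hH : Continuous H)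
    (hper : ∀ z, ∀ l : Λ, H (z + l) = H z) (k a : Euc d) (c : ℂ)
    (hc : ∀ (p : dualLattice Λ →₀ ℂ) (ε : ℝ),
      (∀ z, ‖H z - p.sum fun y c => c * chr y.1 z‖ ≤ ε) →
        ‖c - ∑ y ∈ p.support with y.1.1 = -k, p y‖ ≤ ε) :
    Tendsto (fun r : ℝ => ballAvg a r fun t => (𝐞 (-inner ℝ k t) : ℂ) * H (-t, 0)) atTop
      (𝓝 c) := by
  rw [Metric.tendsto_nhds]
  intro ε hε
  -- One third of ε each for the uniform error of p, the convergence of its averages, and the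
  -- distance from c to their limit.
  obtain ⟨p, hp⟩ := exists_trigPolynomial_near hH hper (ε := ε / 3) (by positivity)
  have h1 := hc p _ hp
  have h2 := Metric.tendsto_nhds.1 (tendsto_ballAvg_trigPolynomial k a p) (ε / 3) (by positivity)
  filter_upwards [h2, eventually_gt_atTop (0 : ℝ)] with r hr hr0
  have h3 : ‖(ballAvg a r fun t => (𝐞 (-inner ℝ k t) : ℂ) * H (-t, 0)) - ballAvg a r fun t =>
      (𝐞 (-inner ℝ k t) : ℂ) * p.sum fun y c => c * chr y.1 (-t, 0)‖ ≤ ε / 3 := by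
    have hHc : Continuous fun t => (𝐞 (-inner ℝ k t) : ℂ) * H (-t, 0) := by fun_prop
    have hpc : Continuous fun t => (𝐞 (-inner ℝ k t) : ℂ) *
        p.sum fun y c => c * chr y.1 (-t, 0) := by
      unfold Finsupp.sum
      fun_prop
    rw [← ballAvg_sub hHc hpc]
    refine norm_ballAvg_le hr0 fun t => ?_
    rw [← mul_sub, norm_mul, Circle.norm_coe, one_mul]
    exact hp _
  rw [dist_eq_norm] at hr ⊢
  set A := ballAvg a r fun t => (𝐞 (-inner ℝ k t) : ℂ) * H (-t, 0)
  set A' := ballAvg a r fun t => (𝐞 (-inner ℝ k t) : ℂ) * p.sum fun y c => c * chr y.1 (-t, 0)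
  set S := ∑ y ∈ p.support with y.1.1 = -k, p y
  calc ‖A - c‖ = ‖(A - A') + (A' - S) - (c - S)‖ := by congr 1; ring
    _ ≤ ‖(A - A') + (A' - S)‖ + ‖c - S‖ := norm_sub_le _ _
    _ ≤ ‖A - A'‖ + ‖A' - S‖ + ‖c - S‖ := by gcongr; exact norm_add_le _ _
    _ < ε := by linarith

theorem tendsto_ballAvg_periodic_of_notMem {H : Euc d × Euc m → ℂ} (hH : Continuous H)
    (hper : ∀ z, ∀ l : Λ, H (z + l) = H z) {k : Euc d}
    (hk : k ∉ directModule (dualLattice Λ)) (a : Euc d) :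
    Tendsto (fun r : ℝ => ballAvg a r fun t => (𝐞 (-inner ℝ k t) : ℂ) * H (-t, 0)) atTop
      (𝓝 0) := by
  classical
  refine tendsto_ballAvg_periodic hH hper k a 0 fun p ε hp => ?_
  rw [Finset.sum_eq_zero, sub_zero, norm_zero]
  · exact (norm_nonneg _).trans (hp 0)
  · intro y hy
    refine absurd ?_ hk
    rw [Finset.mem_filter] at hy
    rw [← neg_neg k, ← hy.2]
    exact neg_mem (Submodule.mem_map_of_mem y.2)

theorem covolume_eq_fundDomain :
    ZLattice.covolume Λ = volume.real (fundDomain Λ) :=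
  ZLattice.covolume_eq_measure_fundamentalDomain Λ volume
    (isAddFundamentalDomain_fundDomain Λ volume)

theorem integrableOn_fundDomain {H : Euc d × Euc m → ℂ} (hH : Continuous H) :
    IntegrableOn H (fundDomain Λ) :=
  (hH.continuousOn.integrableOn_compact
    (isBounded_fundDomain Λ).isCompact_closure).mono_set subset_closure

/-- Orthogonality of the dual characters over a fundamental domain reads off one coefficient. -/
theorem setIntegral_trigPolynomial_mul_chr (p : dualLattice Λ →₀ ℂ) (y₀ : dualLattice Λ) :
    ∫ z in fundDomain Λ, (p.sum fun y c => c * chr y.1 z) * chr (-y₀.1) z =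
      ZLattice.covolume Λ * p y₀ := by
  classical
  have hfun : ∀ z, (p.sum fun y c => c * chr y.1 z) * chr (-y₀.1) z =
      ∑ y ∈ p.support, p y * chr (y.1 - y₀.1) z := by
    intro z
    rw [Finsupp.sum, Finset.sum_mul]
    refine Finset.sum_congr rfl fun y _ => ?_
    rw [sub_eq_add_neg, chr_add_left, mul_assoc]
  simp only [hfun]
  rw [integral_finsetSum]
  · have hterm : ∀ y ∈ p.support, ∫ z in fundDomain Λ, p y * chr (y.1 - y₀.1) z =
        if y = y₀ then ZLattice.covolume Λ * p y else 0 := by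
      intro y _
      rw [integral_const_mul]
      split_ifs with h
      · subst h
        have : ∀ z : Euc d × Euc m, chr (y.1 - y.1) z = 1 := by
          intro z
          simp [chr, pairing]
        simp only [this]
        rw [setIntegral_const, covolume_eq_fundDomain]
        simp [mul_comm]
      · rw [setIntegral_chr_eq_zero (sub_mem y.2 y₀.2), mul_zero]
        exact sub_ne_zero.2 fun h' => h (Subtype.ext h')
    rw [Finset.sum_congr rfl hterm, Finset.sum_ite_eq']
    split_ifs with h
    · rfl
    · rw [Finsupp.notMem_support_iff.1 h, mul_zero]
  · intro y _
    exact integrableOn_fundDomain (by fun_prop)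

/-- Injectivity leaves -y₀ as the only surviving frequency. The coefficient of p there is the mean
of p times `chr y₀`, hence within ε of the mean of H times `chr y₀`. -/
theorem tendsto_ballAvg_periodic_of_mem {H : Euc d × Euc m → ℂ} (hH : Continuous H)
    (hper : ∀ z, ∀ l : Λ, H (z + l) = H z)
    (hinj : Set.InjOn Prod.fst (dualLattice Λ : Set (Euc d × Euc m)))
    (y₀ : dualLattice Λ) (a : Euc d) :
    Tendsto (fun r : ℝ => ballAvg a r fun t =>
      (𝐞 (-inner ℝ y₀.1.1 t) : ℂ) * H (-t, 0)) atTop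
      (𝓝 ((ZLattice.covolume Λ : ℂ)⁻¹ * ∫ z in fundDomain Λ, H z * chr y₀ z)) := by
  classical
  have hcov : 0 < ZLattice.covolume Λ := ZLattice.covolume_pos Λ volume
  refine tendsto_ballAvg_periodic hH hper _ a _ fun p ε hp => ?_
  have hsum : (∑ y ∈ p.support with y.1.1 = -y₀.1.1, p y) =
      p (-y₀) := by
    have hiff : ∀ y : dualLattice Λ,
        y.1.1 = -y₀.1.1 ↔ y = -y₀ := fun y =>
      ⟨fun h => Subtype.ext (hinj y.2 (-y₀).2 h), fun h => by rw [h]; rfl⟩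
    simp only [hiff]
    rw [Finset.sum_filter, Finset.sum_ite_eq']
    split_ifs with h
    · rfl
    · exact (Finsupp.notMem_support_iff.1 h).symm
  have hint := setIntegral_trigPolynomial_mul_chr p (-y₀)
  have hneg : -((-y₀ : dualLattice Λ) : Euc d × Euc m) = y₀ := by simp
  rw [hneg] at hint
  have hHc : Continuous fun z => H z * chr y₀.1 z := by fun_prop
  have hpc : Continuous fun z => (p.sum fun y c => c * chr y.1 z) * chr y₀.1 z := by
    unfold Finsupp.sum
    fun_prop
  have heq : (ZLattice.covolume Λ : ℂ)⁻¹ * (∫ z in fundDomain Λ, H z * chr y₀ z) - p (-y₀) =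
      (ZLattice.covolume Λ : ℂ)⁻¹ *
        ∫ z in fundDomain Λ, (H z - p.sum fun y c => c * chr y.1 z) * chr y₀ z := by
    simp only [sub_mul]
    rw [integral_sub (integrableOn_fundDomain hHc) (integrableOn_fundDomain hpc), hint, mul_sub,
      inv_mul_cancel_left₀ (by exact_mod_cast hcov.ne')]
  rw [hsum, heq, norm_mul, norm_inv, Complex.norm_real, Real.norm_of_nonneg hcov.le,
    inv_mul_le_iff₀ hcov, mul_comm, covolume_eq_fundDomain]
  refine norm_setIntegral_le_of_norm_le_const (measure_fundDomain_lt_top Λ) fun z _ => ?_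
  rw [norm_mul, norm_chr, mul_one]
  exact hp z

end MeanValues

/-! ### Polynomial weights -/

section Weights

/-- The weight `(1 + ‖x‖)^{-s}`. -/
def japWeight {E : Type*} [Norm E] (s : ℝ) (x : E) : ℝ := (1 + ‖x‖) ^ (-s)

theorem japWeight_pos {E : Type*} [NormedAddCommGroup E] (s : ℝ) (x : E) : 0 < japWeight s x := by
  unfold japWeight
  positivity

theorem isModerateWeight_japWeight {E : Type*} [NormedAddCommGroup E] [NormedSpace ℝ E]
    [FiniteDimensional ℝ E] [MeasurableSpace E] [BorelSpace E] (μ : Measure E)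
    [μ.IsAddHaarMeasure] {s : ℝ} (hs : (Module.finrank ℝ E : ℝ) < s) :
    IsModerateWeight μ (japWeight s : E → ℝ) where
  nonneg x := (japWeight_pos s x).le
  integrable := integrable_one_add_norm hs
  exists_le_mul R := by
    have hs0 : 0 ≤ s := (Nat.cast_nonneg _).trans hs.le
    refine ⟨(1 + |R|) ^ s, by positivity, fun x w hw => ?_⟩
    have hwR : ‖w‖ ≤ |R| := hw.trans (le_abs_self R)
    have h1 : 1 + ‖x + w‖ ≤ (1 + |R|) * (1 + ‖x‖) := by
      have := norm_add_le x w
      have : 0 ≤ |R| * ‖x‖ := by positivity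
      linarith
    unfold japWeight
    rw [Real.rpow_neg (by positivity), Real.rpow_neg (by positivity),
      ← div_eq_mul_inv, inv_eq_one_div, div_le_div_iff₀ (by positivity) (by positivity), one_mul,
      ← Real.mul_rpow (by positivity) (by positivity)]
    exact Real.rpow_le_rpow (by positivity) h1 hs0

theorem IsModerateWeight.prod {E F : Type*} [NormedAddCommGroup E] [MeasurableSpace E]
    [NormedAddCommGroup F] [MeasurableSpace F] {μ : Measure E} {ν : Measure F} [SFinite μ]
    [SFinite ν] {J : E → ℝ} {J' : F → ℝ} (hJ : IsModerateWeight μ J)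
    (hJ' : IsModerateWeight ν J') :
    IsModerateWeight (μ.prod ν) (fun z => J z.1 * J' z.2) where
  nonneg z := mul_nonneg (hJ.nonneg _) (hJ'.nonneg _)
  integrable := hJ.integrable.mul_prod hJ'.integrable
  exists_le_mul R := by
    obtain ⟨K, hK0, hK⟩ := hJ.exists_le_mul R
    obtain ⟨K', hK0', hK'⟩ := hJ'.exists_le_mul R
    refine ⟨K * K', by positivity, fun z w hw => ?_⟩
    calc J z.1 * J' z.2 ≤ (K * J (z.1 + w.1)) * (K' * J' (z.2 + w.2)) :=
          mul_le_mul (hK _ _ ((norm_fst_le w).trans hw)) (hK' _ _ ((norm_snd_le w).trans hw))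
            (hJ'.nonneg _) (mul_nonneg hK0 (hJ.nonneg _))
      _ = _ := by rw [Prod.fst_add, Prod.snd_add]; ring

/-- A continuous function with polynomial decay at infinity is dominated by a weight. -/
theorem exists_norm_le_japWeight {E : Type*} [NormedAddCommGroup E] [ProperSpace E] {f : E → ℂ}
    (hf : Continuous f) {s C : ℝ} (hs : 0 ≤ s) (hdecay : ∀ x, ‖x‖ ^ s * ‖f x‖ ≤ C) :
    ∃ M, 0 ≤ M ∧ ∀ x, ‖f x‖ ≤ M * japWeight s x := by
  obtain ⟨M₀, hM₀⟩ := (isCompact_closedBall (0 : E) 1).exists_bound_of_continuousOn hf.continuousOn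
  -- For ‖x‖ ≤ 1, 1 + ‖x‖ ≤ 2 and compactness bounds f; for ‖x‖ ≥ 1, 1 + ‖x‖ ≤ 2‖x‖ and the decay
  -- applies.
  have hM₀0 : 0 ≤ M₀ := (norm_nonneg _).trans (hM₀ 0 (by simp))
  have hC0 : 0 ≤ C := (by positivity : 0 ≤ ‖(0 : E)‖ ^ s * ‖f 0‖).trans (hdecay 0)
  refine ⟨2 ^ s * (M₀ + C), by positivity, fun x => ?_⟩
  unfold japWeight
  rw [Real.rpow_neg (by positivity), ← div_eq_mul_inv, le_div_iff₀ (by positivity)]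
  rcases le_total ‖x‖ 1 with h | h
  · have h1 : (1 + ‖x‖) ^ s ≤ 2 ^ s := Real.rpow_le_rpow (by positivity) (by linarith) hs
    have h2 : ‖f x‖ ≤ M₀ + C := by linarith [hM₀ x (by simpa using h)]
    calc ‖f x‖ * (1 + ‖x‖) ^ s ≤ (M₀ + C) * 2 ^ s := by gcongr
      _ = _ := by ring
  · have h1 : (1 + ‖x‖) ^ s ≤ (2 * ‖x‖) ^ s := Real.rpow_le_rpow (by positivity) (by linarith) hs
    rw [Real.mul_rpow (by positivity) (by positivity)] at h1
    calc ‖f x‖ * (1 + ‖x‖) ^ s ≤ ‖f x‖ * (2 ^ s * ‖x‖ ^ s) := by gcongr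
      _ = 2 ^ s * (‖x‖ ^ s * ‖f x‖) := by ring
      _ ≤ 2 ^ s * (M₀ + C) := by
        gcongr
        linarith [hdecay x]

end Weights

/-! ### Mollifiers and smoothed indicators of balls -/

section Mollifier

variable {d : ℕ}

/-- A continuous probability density supported in the open unit ball. -/
structure IsMollifier (φ : Euc d → ℝ) : Prop where
  continuous : Continuous φ
  nonneg : ∀ x, 0 ≤ φ x
  norm_lt_one : ∀ x, φ x ≠ 0 → ‖x‖ < 1
  integral_eq_one : ∫ x, φ x = 1

theorem exists_isMollifier (d : ℕ) : ∃ φ : Euc d → ℝ, IsMollifier φ := by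
  set β : ContDiffBump (0 : Euc d) := ⟨1 / 2, 1, by norm_num, by norm_num⟩
  refine ⟨β.normed volume, β.continuous_normed, β.nonneg_normed, fun x hx => ?_,
    β.integral_normed⟩
  have : x ∈ Metric.ball (0 : Euc d) β.rOut := by
    rw [← β.support_normed_eq (μ := volume)]
    exact hx
  simpa [β] using this

variable {φ : Euc d → ℝ}

theorem IsMollifier.hasCompactSupport (hφ : IsMollifier φ) : HasCompactSupport φ :=
  HasCompactSupport.intro (isCompact_closedBall (0 : Euc d) 1) fun x hx => by
    by_contra h
    exact hx (by simpa using (hφ.norm_lt_one x h).le)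

theorem IsMollifier.integrable_comp_sub (hφ : IsMollifier φ) (x : Euc d) : Integrable fun t => φ (x - t) :=
  (hφ.continuous.integrable_of_hasCompactSupport hφ.hasCompactSupport).comp_sub_left x

theorem IsMollifier.exists_le_japWeight (hφ : IsMollifier φ) (s : ℝ) :
    ∃ M, 0 ≤ M ∧ ∀ x, φ x ≤ M * japWeight s x := by
  have hc : Continuous fun x => φ x * (1 + ‖x‖) ^ s := by
    refine hφ.continuous.mul ?_
    refine Continuous.rpow_const (by fun_prop) fun x => Or.inl ?_
    positivity
  obtain ⟨M, hM⟩ := hφ.hasCompactSupport.mul_right.exists_bound_of_continuous hc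
  refine ⟨M, (norm_nonneg _).trans (hM 0), fun x => ?_⟩
  unfold japWeight
  rw [Real.rpow_neg (by positivity), ← div_eq_mul_inv, le_div_iff₀ (by positivity)]
  exact (le_abs_self _).trans (hM x)

/-- The mass of t ↦ φ (x - t) lies within distance 1 of x, so only that part of A has to lie in B.
-/
theorem IsMollifier.setIntegral_le_of_forall_mem (hφ : IsMollifier φ) (x : Euc d) {A B : Set (Euc d)}
    (hA : MeasurableSet A) (hB : MeasurableSet B) (h : ∀ t ∈ A, ‖x - t‖ < 1 → t ∈ B) :
    ∫ t in A, φ (x - t) ≤ ∫ t in B, φ (x - t) := by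
  rw [← integral_indicator hA, ← integral_indicator hB]
  refine integral_mono ((hφ.integrable_comp_sub x).indicator hA)
    ((hφ.integrable_comp_sub x).indicator hB) fun t => ?_
  by_cases htA : t ∈ A
  · by_cases ht : φ (x - t) = 0
    · simp [Set.indicator, ht]
    · simp [htA, h t htA (hφ.norm_lt_one _ ht)]
  · rw [Set.indicator_of_notMem htA]
    exact Set.indicator_nonneg (fun t _ => hφ.nonneg _) t

/-- Smoothing the indicator function of a ball changes it only near the sphere. -/
theorem IsMollifier.abs_indicator_sub_le (hφ : IsMollifier φ) (a x : Euc d) (r : ℝ) :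
    |(Metric.closedBall a r).indicator (fun _ => (1 : ℝ)) x -
      ∫ t in Metric.closedBall a r, φ (x - t)| ≤ ∫ t in shell a r 1, φ (x - t) := by
  have hB : MeasurableSet (Metric.closedBall a r) := Metric.isClosed_closedBall.measurableSet
  by_cases hx : x ∈ Metric.closedBall a r
  · have htot : ∫ t, φ (x - t) = 1 := by
      rw [integral_sub_left_eq_self φ volume x, hφ.integral_eq_one]
    have hsplit := integral_add_compl hB (hφ.integrable_comp_sub x)
    have heq : (Metric.closedBall a r).indicator (fun _ => (1 : ℝ)) x -
        ∫ t in Metric.closedBall a r, φ (x - t) = ∫ t in (Metric.closedBall a r)ᶜ, φ (x - t) := by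
      rw [Set.indicator_of_mem hx]
      linarith
    rw [heq, abs_of_nonneg (integral_nonneg fun t => hφ.nonneg _)]
    refine hφ.setIntegral_le_of_forall_mem x hB.compl (measurableSet_shell a r 1) fun t ht hxt => ?_
    rw [← dist_eq_norm] at hxt
    simp only [shell, Set.mem_sdiff, Set.mem_compl_iff, Metric.mem_closedBall, not_le] at ht hx ⊢
    have := dist_triangle t x a
    rw [dist_comm t x] at this
    constructor <;> linarith
  · rw [Set.indicator_of_notMem hx, zero_sub, abs_neg,
      abs_of_nonneg (integral_nonneg fun t => hφ.nonneg _)]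
    refine hφ.setIntegral_le_of_forall_mem x hB (measurableSet_shell a r 1) fun t ht hxt => ?_
    rw [← dist_eq_norm] at hxt
    simp only [shell, Set.mem_sdiff, Metric.mem_closedBall, not_le] at ht hx ⊢
    have := dist_triangle x t a
    constructor <;> linarith

end Mollifier

/-! ### Exchange of lattice sums and integrals -/

section Smoothing

variable {d m : ℕ} {Λ : Submodule ℤ (Euc d × Euc m)} [DiscreteTopology Λ] [IsZLattice ℝ Λ]

theorem isModerateWeight_prod {s : ℝ} (hs : (m : ℝ) < s) :
    IsModerateWeight (volume : Measure (Euc d × Euc m))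
      (fun z => japWeight ((d : ℝ) + 1) z.1 * japWeight s z.2) :=
  (isModerateWeight_japWeight volume (by simp)).prod
    (isModerateWeight_japWeight volume (by simpa using hs))

/-- Summation over the lattice and integration of mollifiers may be interchanged. -/
theorem hasSum_setIntegral_mollifier {G : Type*} [NormedAddCommGroup G] [NormedSpace ℝ G]
    [CompleteSpace G] {φ : Euc d → ℝ} (hφ : IsMollifier φ) {s M : ℝ} (hs : (m : ℝ) < s)
    {g : Λ → G} (hg : ∀ l : Λ, ‖g l‖ ≤ M * japWeight s l.1.2) {A : Set (Euc d)}
    (hA : MeasurableSet A) (hAb : Bornology.IsBounded A) :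
    HasSum (fun l : Λ => (∫ t in A, φ (l.1.1 - t)) • g l)
      (∫ t in A, ∑' l : Λ, φ (l.1.1 - t) • g l) := by
  obtain ⟨Mφ, hMφ, hφM⟩ := hφ.exists_le_japWeight ((d : ℝ) + 1)
  obtain ⟨R, hR⟩ := hAb.exists_norm_le
  have hJ := isModerateWeight_japWeight (volume : Measure (Euc d)) (s := (d : ℝ) + 1) (by simp)
  obtain ⟨K, hK0, hK⟩ := hJ.exists_le_mul R
  -- Uniformly for t in the bounded set A, φ (l₁ - t) decays in l₁. This supplies the decay along ℝᵈ
  -- missing from the bound on g, and the product weight is summable over Λ.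
  have hbound : ∀ l : Λ, ∀ t ∈ A, φ (l.1.1 - t) ≤ Mφ * (K * japWeight ((d : ℝ) + 1) l.1.1) := by
    intro l t ht
    refine (hφM _).trans (mul_le_mul_of_nonneg_left ?_ hMφ)
    simpa using hK (l.1.1 - t) t (hR t ht)
  have hint : ∀ l : Λ, Integrable (fun t => φ (l.1.1 - t) • g l) (volume.restrict A) := fun l =>
    (hφ.integrable_comp_sub _).integrableOn.smul_const _
  have hsum := (isModerateWeight_prod (d := d) hs).summable (L := Λ)
  have hsm : Summable fun l : Λ => ∫ t in A, ‖φ (l.1.1 - t) • g l‖ := by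
    refine Summable.of_nonneg_of_le (fun l => integral_nonneg fun _ => norm_nonneg _) (fun l => ?_)
      (hsum.mul_left (volume.real A * Mφ * K * M))
    have hfin : volume A ≠ ⊤ := hAb.measure_lt_top.ne
    calc ∫ t in A, ‖φ (l.1.1 - t) • g l‖
        ≤ ∫ t in A, Mφ * (K * japWeight ((d : ℝ) + 1) l.1.1) * (M * japWeight s l.1.2) := by
          refine setIntegral_mono_on (hint l).norm (integrableOn_const hfin) hA fun t ht => ?_
          rw [norm_smul, Real.norm_of_nonneg (hφ.nonneg _)]
          exact mul_le_mul (hbound l t ht) (hg l) (norm_nonneg _)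
            ((hφ.nonneg _).trans (hbound l t ht))
      _ = _ := by
          rw [setIntegral_const, smul_eq_mul]
          ring
  have := hasSum_integral_of_summable_integral_norm hint hsm
  simpa only [integral_smul_const] using this

end Smoothing

/-! ### Comparison of sharp and smoothed sums -/

section SmoothedSums

variable {d m : ℕ} {Λ : Submodule ℤ (Euc d × Euc m)} [DiscreteTopology Λ] [IsZLattice ℝ Λ]

/-- The term `f(l₂) e^{-2πi k·l₁}` of a lattice point `l = (l₁, l₂)`. -/
def latticeTerm (f : Euc m → ℂ) (k : Euc d) (l : Euc d × Euc m) : ℂ :=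
  (𝐞 (-inner ℝ k l.1) : ℂ) * f l.2

theorem norm_latticeTerm (f : Euc m → ℂ) (k : Euc d) (l : Euc d × Euc m) :
    ‖latticeTerm f k l‖ = ‖f l.2‖ := by
  rw [latticeTerm, norm_mul, Circle.norm_coe, one_mul]

/-- The function `(x, u) ↦ φ(x) e^{-2πi k·x} f(u)`. -/
def mollifiedTerm (φ : Euc d → ℝ) (f : Euc m → ℂ) (k : Euc d) (z : Euc d × Euc m) : ℂ :=
  φ z.1 * latticeTerm f k z

theorem continuous_mollifiedTerm {φ : Euc d → ℝ} (hφ : Continuous φ) {f : Euc m → ℂ}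
    (hf : Continuous f) (k : Euc d) : Continuous (mollifiedTerm φ f k) := by
  unfold mollifiedTerm latticeTerm
  fun_prop

theorem exists_norm_mollifiedTerm_le {φ : Euc d → ℝ} (hφ : IsMollifier φ) {f : Euc m → ℂ}
    {s M : ℝ} (hM : 0 ≤ M) (hfM : ∀ u, ‖f u‖ ≤ M * japWeight s u) (k : Euc d) :
    ∃ M', 0 ≤ M' ∧ ∀ z : Euc d × Euc m,
      ‖mollifiedTerm φ f k z‖ ≤ M' * (japWeight ((d : ℝ) + 1) z.1 * japWeight s z.2) := by
  obtain ⟨Mφ, hMφ, hφM⟩ := hφ.exists_le_japWeight ((d : ℝ) + 1)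
  refine ⟨Mφ * M, by positivity, fun z => ?_⟩
  rw [mollifiedTerm, norm_mul, norm_latticeTerm, Complex.norm_real,
    Real.norm_of_nonneg (hφ.nonneg _), mul_mul_mul_comm]
  exact mul_le_mul (hφM _) (hfM _) (norm_nonneg _) ((hφ.nonneg _).trans (hφM _))

/-- Splitting e^{-2πi k·l₁} into its values at t and l₁ - t exhibits the smoothed sum as a twisted
periodic function along the slice (-t, 0). -/
theorem periodize_mollifiedTerm (φ : Euc d → ℝ) (f : Euc m → ℂ) (k t : Euc d) :
    (𝐞 (-inner ℝ k t) : ℂ) * periodize Λ (mollifiedTerm φ f k) (-t, 0) =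
      ∑' l : Λ, φ (l.1.1 - t) • latticeTerm f k l := by
  rw [periodize, ← tsum_mul_left]
  refine tsum_congr fun l => ?_
  have hsplit : (𝐞 (-inner ℝ k l.1.1) : ℂ) =
      𝐞 (-inner ℝ k t) * 𝐞 (-inner ℝ k (-t + l.1.1)) := by
    rw [← Circle.coe_mul, ← AddChar.map_add_eq_mul]
    congr 2
    rw [inner_add_right, inner_neg_right]
    ring
  simp only [mollifiedTerm, latticeTerm, Prod.fst_add, Prod.snd_add, zero_add, Complex.real_smul]
  rw [hsplit, sub_eq_neg_add]
  ring

/-- Sums of absolute values over points in a thin set are controlled by its volume. -/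
theorem exists_setIntegral_tsum_le {φ : Euc d → ℝ} (hφ : IsMollifier φ) {f : Euc m → ℂ}
    (hf : Continuous f) {s M : ℝ} (hs : (m : ℝ) < s) (hM : 0 ≤ M)
    (hfM : ∀ u, ‖f u‖ ≤ M * japWeight s u) :
    ∃ K, 0 ≤ K ∧ ∀ A : Set (Euc d), Bornology.IsBounded A →
      ∫ t in A, ∑' l : Λ, φ (l.1.1 - t) • ‖f l.1.2‖ ≤ K * volume.real A := by
  -- With |f| for f and k = 0, the sum is the periodization of a dominated continuous function,
  -- hence bounded uniformly in t.
  set f' : Euc m → ℂ := fun u => ((‖f u‖ : ℝ) : ℂ) with hf'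
  have hf'c : Continuous f' := by fun_prop
  have hf'M : ∀ u, ‖f' u‖ ≤ M * japWeight s u := fun u => by simpa [hf'] using hfM u
  obtain ⟨M', hM', hq⟩ := exists_norm_mollifiedTerm_le hφ hM hf'M 0
  have hJ := isModerateWeight_prod (d := d) hs
  obtain ⟨K, hK0, hK⟩ := exists_norm_le_of_periodic (L := Λ)
    (hJ.continuous_periodize hM' hq (continuous_mollifiedTerm hφ.continuous hf'c 0))
    (periodize_add _)
  refine ⟨K, hK0, fun A hA => ?_⟩
  refine (Real.le_norm_self _).trans
    (norm_setIntegral_le_of_norm_le_const hA.measure_lt_top fun t _ => ?_)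
  refine le_of_eq_of_le ?_ (hK (-t, 0))
  have h := periodize_mollifiedTerm (Λ := Λ) φ f' 0 t
  simp only [inner_zero_left, neg_zero, AddChar.map_zero_eq_one, Circle.coe_one, one_mul,
    latticeTerm, hf', Complex.real_smul] at h
  rw [h, ← Complex.norm_real, Complex.ofReal_tsum]
  simp

/-- The indicator sum over a ball, at a lattice point. -/
def ballTerm (f : Euc m → ℂ) (k a : Euc d) (r : ℝ) (l : Euc d × Euc m) : ℂ :=
  (Metric.closedBall a r).indicator (fun _ => (1 : ℝ)) l.1 • latticeTerm f k l

/-- The ball restricts only l₁; the decay of f handles l₂. By moderateness the indicator of the ball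
is at most a multiple of the weight in l₁, so the product weight dominates. -/
theorem summable_ballTerm {f : Euc m → ℂ} {s M : ℝ} (hs : (m : ℝ) < s)
    (hfM : ∀ u, ‖f u‖ ≤ M * japWeight s u) (k a : Euc d) (r : ℝ) :
    Summable fun l : Λ => ballTerm f k a r l := by
  have hsum := (isModerateWeight_prod (d := d) hs).summable (L := Λ)
  set w := japWeight ((d : ℝ) + 1) (E := Euc d)
  have hJ := isModerateWeight_japWeight (volume : Measure (Euc d)) (s := (d : ℝ) + 1) (by simp)
  obtain ⟨K, hK0, hK⟩ := hJ.exists_le_mul (‖a‖ + |r|)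
  refine Summable.of_norm_bounded (hsum.mul_left (K * M)) fun l => ?_
  rw [ballTerm, norm_smul, norm_latticeTerm]
  have hone : ‖(Metric.closedBall a r).indicator (fun _ => (1 : ℝ)) l.1.1‖ ≤ K * w l.1.1 := by
    by_cases h : l.1.1 ∈ Metric.closedBall a r
    · have hn : ‖l.1.1‖ ≤ ‖a‖ + |r| := by
        rw [Metric.mem_closedBall, dist_eq_norm] at h
        have := norm_add_le a (l.1.1 - a)
        rw [add_sub_cancel] at this
        linarith [le_abs_self r]
      have h0 := hK 0 l.1.1 hn
      rw [zero_add] at h0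
      rw [Set.indicator_of_mem h, norm_one]
      refine le_of_eq_of_le ?_ h0
      simp [japWeight]
    · rw [Set.indicator_of_notMem h, norm_zero]
      exact mul_nonneg hK0 (japWeight_pos _ _).le
  calc _ ≤ (K * w l.1.1) * (M * japWeight s l.1.2) :=
        mul_le_mul hone (hfM _) (norm_nonneg _) ((norm_nonneg _).trans hone)
    _ = _ := by ring

/-- Termwise the difference is at most |f(l₂)| times the mollifier mass in the shell. Summed over Λ
this is at most K times the shell volume, negligible against the ball volume. -/
theorem tendsto_ballTerm_sub_ballAvg {φ : Euc d → ℝ} (hφ : IsMollifier φ) {f : Euc m → ℂ}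
    (hf : Continuous f) {s M : ℝ} (hs : (m : ℝ) < s) (hM : 0 ≤ M)
    (hfM : ∀ u, ‖f u‖ ≤ M * japWeight s u) (k a : Euc d) :
    Tendsto (fun r : ℝ => ((ballVol d r : ℝ) : ℂ)⁻¹ * (∑' l : Λ, ballTerm f k a r l) -
      ballAvg a r fun t => (𝐞 (-inner ℝ k t) : ℂ) *
        periodize Λ (mollifiedTerm φ f k) (-t, 0)) atTop (𝓝 0) := by
  obtain ⟨K, hK0, hK⟩ := exists_setIntegral_tsum_le (Λ := Λ) hφ hf hs hM hfM
  have hlim := (tendsto_volume_shell_div a zero_le_one).const_mul K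
  rw [mul_zero] at hlim
  refine squeeze_zero_norm' ?_ hlim
  filter_upwards [eventually_gt_atTop (0 : ℝ)] with r hr
  have hT := hasSum_setIntegral_mollifier hφ hs (g := fun l : Λ => latticeTerm f k l)
    (fun l => (norm_latticeTerm f k l.1).le.trans (hfM _))
    (A := Metric.closedBall a r) Metric.isClosed_closedBall.measurableSet
    Metric.isBounded_closedBall
  have hE := hasSum_setIntegral_mollifier hφ hs (g := fun l : Λ => ‖f l.1.2‖)
    (fun l => by simpa using hfM l.1.2) (measurableSet_shell a r 1) (isBounded_shell a r 1)
  have hS := (summable_ballTerm (Λ := Λ) hs hfM k a r).hasSum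
  simp only [ballAvg, periodize_mollifiedTerm]
  rw [← mul_sub, norm_ballVol_inv_mul, ← mul_div_assoc]
  refine div_le_div_of_nonneg_right ?_ (ballVol_pos hr).le
  refine le_trans ?_ (hK _ (isBounded_shell a r 1))
  rw [← (hS.sub hT).tsum_eq]
  refine tsum_of_norm_bounded hE fun l => ?_
  rw [ballTerm, ← sub_smul, norm_smul, norm_latticeTerm, smul_eq_mul]
  exact mul_le_mul_of_nonneg_right (hφ.abs_indicator_sub_le a l.1.1 r) (norm_nonneg _)

/-- Since `chr y₀` is Λ-periodic, it moves inside the periodization. After unfolding, the phases in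
x cancel and Fubini splits off ∫ φ = 1. -/
theorem setIntegral_periodize_mollifiedTerm_mul_chr {φ : Euc d → ℝ} (hφ : IsMollifier φ)
    {f : Euc m → ℂ} (hf : Continuous f) {s M : ℝ} (hs : (m : ℝ) < s) (hM : 0 ≤ M)
    (hfM : ∀ u, ‖f u‖ ≤ M * japWeight s u) (y₀ : dualLattice Λ) :
    ∫ z in fundDomain Λ, periodize Λ (mollifiedTerm φ f y₀.1.1) z * chr y₀.1 z =
      ∫ u, (𝐞 (inner ℝ y₀.1.2 u) : ℂ) * f u := by
  obtain ⟨M', hM', hq⟩ := exists_norm_mollifiedTerm_le hφ hM hfM y₀.1.1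
  have hJ := isModerateWeight_prod (d := d) hs
  have hper : ∀ z, periodize Λ (mollifiedTerm φ f y₀.1.1) z * chr y₀.1 z =
      periodize Λ (fun z => mollifiedTerm φ f y₀.1.1 z * chr y₀.1 z) z := by
    intro z
    rw [periodize, periodize, ← tsum_mul_right]
    refine tsum_congr fun l => ?_
    rw [chr_add_right, chr_eq_one y₀.2, mul_one]
  have hqc := continuous_mollifiedTerm hφ.continuous hf y₀.1.1
  simp only [hper]
  rw [hJ.setIntegral_periodize hM' (fun z => by simpa using hq z) (by fun_prop)]
  have hfun : ∀ z : Euc d × Euc m, mollifiedTerm φ f y₀.1.1 z * chr y₀.1 z =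
      ((φ z.1 : ℝ) : ℂ) * ((𝐞 (inner ℝ y₀.1.2 z.2) : ℂ) * f z.2) := by
    intro z
    have : (𝐞 (-inner ℝ y₀.1.1 z.1) : ℂ) * chr y₀.1 z = 𝐞 (inner ℝ y₀.1.2 z.2) := by
      rw [chr, ← Circle.coe_mul, ← AddChar.map_add_eq_mul]
      congr 2
      rw [pairing]
      ring
    rw [← this, mollifiedTerm, latticeTerm]
    ring
  simp only [hfun]
  rw [Measure.volume_eq_prod, integral_prod_mul (fun x => ((φ x : ℝ) : ℂ))
    (fun u => (𝐞 (inner ℝ y₀.1.2 u) : ℂ) * f u), integral_complex_ofReal, hφ.integral_eq_one]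
  simp

end SmoothedSums

/-! ### From sums over π₁(Λ) to sums over Λ -/

section Reindexing

variable {d m : ℕ} {Λ : Submodule ℤ (Euc d × Euc m)}

/-- The lattice is parametrized by its projection if the projection is one-to-one. -/
def latticeEquiv (h : Set.InjOn Prod.fst (Λ : Set (Euc d × Euc m))) : directModule Λ ≃ Λ where
  toFun x := ⟨(x, starMap Λ x), mk_starMap_mem Λ x⟩
  invFun l := ⟨l.1.1, Submodule.mem_map_of_mem (f := LinearMap.fst ℤ _ _) l.2⟩
  left_inv _ := rfl
  right_inv l := Subtype.ext (h (mk_starMap_mem Λ _) l.2 rfl)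

theorem ballTerm_latticeEquiv (h : Set.InjOn Prod.fst (Λ : Set (Euc d × Euc m))) (f : Euc m → ℂ)
    (k a : Euc d) (r : ℝ) (x : directModule Λ) :
    ballTerm f k a r (latticeEquiv h x) =
      (pointsInBall Λ a r).indicator (bohrTerm Λ f k) x := by
  have hterm : latticeTerm f k (latticeEquiv h x) = bohrTerm Λ f k x := by
    rw [latticeTerm, bohrTerm, mul_comm, Real.fourierChar_apply]
    simp only [latticeEquiv, Equiv.coe_fn_mk]
    congr 2
    push_cast
    ring
  rw [ballTerm, hterm]
  by_cases hx : x ∈ pointsInBall Λ a r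
  · rw [Set.indicator_of_mem hx,
      Set.indicator_of_mem (show (latticeEquiv h x).1.1 ∈ Metric.closedBall a r from hx),
      one_smul]
  · rw [Set.indicator_of_notMem hx,
      Set.indicator_of_notMem (show (latticeEquiv h x).1.1 ∉ Metric.closedBall a r from hx), zero_smul]

theorem bohrApprox_eq (h : Set.InjOn Prod.fst (Λ : Set (Euc d × Euc m))) (f : Euc m → ℂ)
    (k a : Euc d) (r : ℝ) :
    bohrApprox Λ f k a r = ((ballVol d r : ℝ) : ℂ)⁻¹ * ∑' l : Λ, ballTerm f k a r l := by
  rw [bohrApprox, tsum_subtype, ← (latticeEquiv h).tsum_eq]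
  simp only [ballTerm_latticeEquiv]
  rfl

theorem summable_bohrTerm_iff (h : Set.InjOn Prod.fst (Λ : Set (Euc d × Euc m))) (f : Euc m → ℂ)
    (k a : Euc d) (r : ℝ) :
    (Summable fun x : pointsInBall Λ a r => bohrTerm Λ f k x) ↔
      Summable fun l : Λ => ballTerm f k a r l := by
  rw [← (latticeEquiv h).summable_iff]
  simp only [Function.comp_def, ballTerm_latticeEquiv]
  exact summable_subtype_iff_indicator (f := bohrTerm Λ f k)

end Reindexing

end CutProject

end

/-! ### The Fourier–Bohr coefficients -/

open CutProject in
theorem theorem3p3 {d m : ℕ}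
    (Λ : Submodule ℤ (CutProject.Euc d × CutProject.Euc m))
    [DiscreteTopology Λ] [IsZLattice ℝ Λ]
    (hinj₁ : Set.InjOn Prod.fst (Λ : Set (CutProject.Euc d × CutProject.Euc m)))
    (hinj₂ : Set.InjOn Prod.snd (Λ : Set (CutProject.Euc d × CutProject.Euc m)))
    (hdense₁ : Dense (Prod.fst '' (Λ : Set (CutProject.Euc d × CutProject.Euc m))))
    (hdense₂ : Dense (Prod.snd '' (Λ : Set (CutProject.Euc d × CutProject.Euc m))))
    (f : CutProject.Euc m → ℂ) (hf : Continuous f)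
    (C α : ℝ) (hC : 0 < C) (hα : 0 < α)
    (hdecay : ∀ x : CutProject.Euc m, ‖x‖ ^ ((m : ℝ) + 1 + α) * ‖f x‖ ≤ C) :
    Integrable f ∧
    ∀ k : CutProject.Euc d,
      (∀ (a : CutProject.Euc d) (r : ℝ),
        Summable fun x : CutProject.pointsInBall Λ a r => CutProject.bohrTerm Λ f k x) ∧
      ∃ c : ℂ,
        (∀ a : CutProject.Euc d,
          Tendsto (fun r : ℝ => CutProject.bohrApprox Λ f k a r) atTop (𝓝 c)) ∧
        (∀ hk : k ∈ CutProject.directModule (CutProject.dualLattice Λ),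
          c = ((ZLattice.covolume Λ : ℝ) : ℂ)⁻¹ *
              ∫ u : CutProject.Euc m,
                Complex.exp (2 * Real.pi * Complex.I *
                  (inner ℝ (CutProject.starMap (CutProject.dualLattice Λ) ⟨k, hk⟩) u : ℝ)) *
                  f u ∧
          c = ((ZLattice.covolume Λ : ℝ) : ℂ)⁻¹ *
              𝓕 f (-CutProject.starMap (CutProject.dualLattice Λ) ⟨k, hk⟩)) ∧
        (k ∉ CutProject.directModule (CutProject.dualLattice Λ) → c = 0) := by
  have hs : (m : ℝ) < (m : ℝ) + 1 + α := by linarith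
  obtain ⟨M, hM, hfM⟩ := exists_norm_le_japWeight hf ((Nat.cast_nonneg m).trans hs.le) hdecay
  have hJ := isModerateWeight_japWeight (volume : Measure (Euc m)) (s := (m : ℝ) + 1 + α)
    (by simpa using hs)
  refine ⟨(hJ.integrable.const_mul M).mono' hf.aestronglyMeasurable (ae_of_all _ hfM),
    fun k => ⟨fun a r => (summable_bohrTerm_iff hinj₁ f k a r).2
      (summable_ballTerm hs hfM k a r), ?_⟩⟩
  obtain ⟨φ, hφ⟩ := exists_isMollifier d
  obtain ⟨M', hM', hq⟩ := exists_norm_mollifiedTerm_le hφ hM hfM k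
  have hHc : Continuous (periodize Λ (mollifiedTerm φ f k)) :=
    (isModerateWeight_prod hs).continuous_periodize hM' hq
      (continuous_mollifiedTerm hφ.continuous hf k)
  have hper := periodize_add (L := Λ) (mollifiedTerm φ f k)
  -- The sharp and smoothed averages differ by o(1), so a limit of the latter is one of the former.
  have hlim : ∀ {c : ℂ} {a : Euc d}, Tendsto (fun r : ℝ => ballAvg a r fun t =>
      (𝐞 (-inner ℝ k t) : ℂ) * periodize Λ (mollifiedTerm φ f k) (-t, 0)) atTop (𝓝 c) →
      Tendsto (fun r : ℝ => bohrApprox Λ f k a r) atTop (𝓝 c) := by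
    intro c a h
    have hsum := (tendsto_ballTerm_sub_ballAvg (Λ := Λ) hφ hf hs hM hfM k a).add h
    simpa only [sub_add_cancel, zero_add, ← bohrApprox_eq hinj₁] using hsum
  by_cases hk : k ∈ directModule (dualLattice Λ)
  · set y₀ : dualLattice Λ := ⟨_, mk_starMap_mem (dualLattice Λ) ⟨k, hk⟩⟩
    refine ⟨_, fun a => hlim (tendsto_ballAvg_periodic_of_mem hHc hper
      (injOn_fst_dualLattice hdense₂) y₀ a), fun _ => ?_, fun h => absurd hk h⟩
    have hint := setIntegral_periodize_mollifiedTerm_mul_chr hφ hf hs hM hfM y₀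
    rw [hint]
    constructor
    · congr 2
      funext u
      rw [Real.fourierChar_apply]
      congr 2
      push_cast
      ring
    · rw [Real.fourier_eq]
      congr 2
      funext u
      -- The minus sign in the Fourier kernel cancels against that of the argument -k^⋆.
      rw [inner_neg_right, neg_neg, real_inner_comm]
      rfl
  · exact ⟨0, fun a => hlim (tendsto_ballAvg_periodic_of_notMem hHc hper hk a),
      fun h => absurd h hk, fun _ => rfl⟩
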